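/- Let $S=\mathbb{C}[x,y,z]$ and let $C: f=0$ be a reduced curve of degree $d\ge 3$ in the complex projective plane $\mathbb{P}^2$. Let $J_f=(f_x,f_y,f_z)\subset S$ be the Jacobian ideal, $M(f)=S/J_f$ the Milnor algebra, and $D_0(f)=\{(a,b,c)\in S^3 : af_x+bf_y+cf_z=0\}$ the graded module of Jacobian syzygies. Suppose that $C$ is a curve of type $(d,r,m)$, i.e. that $D_0(f)$ is minimally generated by $m$ homogeneous syzygies, all of the same degree $r$. Put $\Delta m=(2r-d+3)-m$. Then the following hold. (1) $M(f)$ has a minimal graded free resolution of the form $$0\to\bigoplus_{i=1}^{m-2}S(-e_i)\to S(1-d-r)^m\to S(1-d)^3\to S,$$ whose last map is $(a,b,c)\mapsto af_x+bf_y+cf_z$, and every minimal graded free resolution $0\to\bigoplus_{i=1}^{n} S(-e_i)\to\bigoplus_{j=1}^{k} S(-b_j)\to S(1-d)^3\to S$ of $M(f)$ with this last map has this form, i.e. $k=m$, $n=m-2$ and $b_j=d-1+r$ for all $j$. Moreover $e_j=d+r-1+\epsilon_j$ with integers $\epsilon_j\ge 1$, and $$\Delta m=\sum_{j=1}^{m-2}(\epsilon_j-1).$$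 (2) If $m=3$, then all the degrees in the resolution are determined by $(d,r)$: it is $$0\to S(-3r)\to S(1-d-r)^3\to S(1-d)^3\to S,$$ that is, $e_1=3r$. (3) If $m=3$, then the total Tjurina number $\tau(C)$, i.e. the degree of the Jacobian ideal $J_f$ (the constant value of $\dim_{\mathbb{C}} M(f)_k$ for all large $k$), is $$\tau(C)=3r(d-1-r).$$ -/

import Mathlib

namespace PlaneCurve

/-- The polynomial ring `S = ℂ[x, y, z]`. -/
abbrev S : Type := MvPolynomial (Fin 3) ℂ

/-- The Jacobian ideal `J_f`, generated by the partial derivatives of `f`. -/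
noncomputable def jacobianIdeal (f : S) : Ideal S :=
  Ideal.span (Set.range fun i : Fin 3 => MvPolynomial.pderiv i f)

/-- The Milnor (Jacobian) algebra `M(f) = S / J_f`. -/
abbrev MilnorAlgebra (f : S) : Type := S ⧸ jacobianIdeal f

/-- The component of degree `k` of `M(f)`: the classes of the forms of degree `k`. -/
noncomputable def milnorComponent (f : S) (k : ℕ) : Submodule ℂ (MilnorAlgebra f) :=
  (MvPolynomial.homogeneousSubmodule (Fin 3) ℂ k).map
    (Ideal.Quotient.mkₐ ℂ (jacobianIdeal f)).toLinearMap

/-- `τ` is the total Tjurina number of the curve `f = 0`, that is, the degree of its Jacobian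
ideal: the Hilbert polynomial of `M(f) = S / J_f` is the constant `τ`, in other words
`dim M(f)_k = τ` for all large `k`. At most one `τ` has this property. -/
def HasTotalTjurinaNumber (f : S) (τ : ℤ) : Prop :=
  ∀ᶠ k : ℕ in Filter.atTop, (Module.finrank ℂ (milnorComponent f k) : ℤ) = τ

/-- The map `S³ → S`, `(a, b, c) ↦ a f_x + b f_y + c f_z`. -/
noncomputable def jacobianMap (f : S) : (Fin 3 → S) →ₗ[S] S :=
  Fintype.linearCombination S (fun i : Fin 3 => MvPolynomial.pderiv i f)

/-- The module `D₀(f)` of Jacobian syzygies of `f`. -/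
noncomputable def jacobianSyzygies (f : S) : Submodule S (Fin 3 → S) :=
  LinearMap.ker (jacobianMap f)

/-- `D₀(f)` is minimally generated by `m` homogeneous syzygies of degrees `δ 0 ≤ δ 1 ≤ …`:
`f = 0` is an `m`-syzygy curve with exponents `δ`. -/
def HasExponents (f : S) {m : ℕ} (δ : Fin m → ℕ) : Prop :=
  Monotone δ ∧ ∃ ρ : Fin m → (Fin 3 → S),
    (∀ j i, (ρ j i).IsHomogeneous (δ j)) ∧
    Submodule.span S (Set.range ρ) = jacobianSyzygies f ∧
    ∀ j, ρ j ∉ Submodule.span S (ρ '' {i | i ≠ j})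

/-- `f = 0` is a curve of type `(d, r, m)`: a reduced plane curve of degree `d ≥ 3` whose module
of Jacobian syzygies is minimally generated by `m` homogeneous syzygies, all of degree `r`. -/
structure IsCurveOfType (f : S) (d r m : ℕ) : Prop where
  three_le : 3 ≤ d
  homogeneous : f.IsHomogeneous d
  reduced : Squarefree f
  exponents : HasExponents f (fun _ : Fin m => r)

/-- `p` is homogeneous of degree `k`, with `k` an integer (so `p = 0` if `k < 0`). -/
def IsHomogeneousZ (p : S) (k : ℤ) : Prop :=
  ∀ s ∈ p.support, ((Finsupp.degree s : ℕ) : ℤ) = k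

theorem isHomogeneousZ_natCast (p : S) (k : ℕ) :
    IsHomogeneousZ p (k : ℤ) ↔ p.IsHomogeneous k := by
  simp only [IsHomogeneousZ, MvPolynomial.IsHomogeneous, MvPolynomial.IsWeightedHomogeneous,
    MvPolynomial.mem_support_iff, Finsupp.degree_eq_weight_one, Nat.cast_inj]
  exact ⟨fun h s hs => h s hs, fun h s hs => h hs⟩

/-- A homomorphism `⨁ⱼ S(-b j) → ⨁ᵢ S(-a i)` of graded modules (homogeneous of degree `0`): it
sends the `j`-th basis vector, which has degree `b j`, to an element of degree `b j`, whose
`i`-th coordinate is therefore a form of degree `b j - a i`. -/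
def IsGradedHom {p q : ℕ} (b : Fin p → ℤ) (a : Fin q → ℤ)
    (φ : (Fin p → S) →ₗ[S] (Fin q → S)) : Prop :=
  ∀ j i, IsHomogeneousZ (φ (Pi.single j 1) i) (b j - a i)

/-- The entries of the matrix of `φ` lie in the ideal `(x, y, z)`. -/
def IsMinimalHom {p q : ℕ} (φ : (Fin p → S) →ₗ[S] (Fin q → S)) : Prop :=
  ∀ j i, MvPolynomial.constantCoeff (φ (Pi.single j 1) i) = 0

/-- The Milnor algebra `M(f)` of a form `f` of degree `d` has a minimal graded free resolution
`0 → ⨁_{i < n} S(-e i) → ⨁_{j < k} S(-b j) → S(1-d)³ → S`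
whose last map is `(a, b, c) ↦ a f_x + b f_y + c f_z`, with cokernel `M(f)`. The entries of this
last map are forms of degree `d - 1`, so for `d ≥ 2` minimality only concerns the other two. The
order of the degrees `b j` and `e i` is left free. -/
def HasMinimalResolution (f : S) (d : ℕ) {k n : ℕ} (b : Fin k → ℤ) (e : Fin n → ℤ) : Prop :=
  ∃ (φ : (Fin k → S) →ₗ[S] (Fin 3 → S)) (ψ : (Fin n → S) →ₗ[S] (Fin k → S)),
    IsGradedHom b (fun _ => (d : ℤ) - 1) φ ∧ IsGradedHom e b ψ ∧
    IsMinimalHom φ ∧ IsMinimalHom ψ ∧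
    LinearMap.range φ = LinearMap.ker (jacobianMap f) ∧
    LinearMap.range ψ = LinearMap.ker φ ∧
    Function.Injective ψ

/-- `m(d, r)_max = 2r - d + 3`. -/
def mMax (d r : ℕ) : ℤ := 2 * (r : ℤ) - (d : ℤ) + 3

/-- The defect `Δm = m(d, r)_max - m`. -/
def defect (d r m : ℕ) : ℤ := mMax d r - (m : ℤ)

end PlaneCurve

namespace PlaneCurve

open MvPolynomial

/-! Minimal homogeneous generators of `D₀(f)` define the middle map `φ`. Its kernel is a graded
third syzygy module over a polynomial ring in three variables, so minimal homogeneous generators of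
it are linearly independent (`linearIndependent_of_minimal`, the needed case of Hilbert's syzygy
theorem). This gives the resolution.

Counting dimensions along any such resolution, `dim M(f)_k` is for large `k` a quadratic polynomial
in `k`. Since `f` is reduced, `J_f` contains two coprime forms of degree `d - 1`, so `dim M(f)_k ≤
(d - 1)²`. Hence the coefficients of `k²` and `k` vanish (`resolution_numerics`). The first yields
`n = m - 2`; the second yields the sum of the `e i`, which is the formula for the defect. For `m =
3` there is a single `e i`, so the sum determines it, and the constant term is the Tjurina number.

Any other minimal resolution has the same `k` and `b j`, because the constant terms of the two
changes of generators are mutually inverse matrices (`minimal_generators_unique`). -/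

/-! ### Forms of integer degree and graded free modules. -/

theorem isHomogeneousZ_iff {p : S} {k : ℤ} :
    IsHomogeneousZ p k ↔ p.IsWeightedHomogeneous (fun _ : Fin 3 => (1 : ℤ)) k := by
  have h : ∀ s : Fin 3 →₀ ℕ, Finsupp.weight (fun _ : Fin 3 => (1 : ℤ)) s
      = ((Finsupp.degree s : ℕ) : ℤ) := by
    intro s
    simp [Finsupp.weight_apply, Finsupp.degree_apply, Finsupp.sum]
  constructor
  · intro hp s hs
    rw [h]
    exact hp s (mem_support_iff.2 hs)
  · intro hp s hs
    rw [← h]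
    exact hp (mem_support_iff.1 hs)

/-- The space of forms of degree `k`, with `k` an integer. -/
noncomputable def forms (k : ℤ) : Submodule ℂ S :=
  weightedHomogeneousSubmodule ℂ (fun _ : Fin 3 => (1 : ℤ)) k

theorem mem_forms {p : S} {k : ℤ} : p ∈ forms k ↔ IsHomogeneousZ p k :=
  isHomogeneousZ_iff.symm

theorem mem_forms_natCast {p : S} {k : ℕ} : p ∈ forms k ↔ p.IsHomogeneous k :=
  mem_forms.trans (isHomogeneousZ_natCast p k)

theorem mul_mem_forms {p q : S} {k l : ℤ} (hp : p ∈ forms k) (hq : q ∈ forms l) :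
    p * q ∈ forms (k + l) :=
  IsWeightedHomogeneous.mul hp hq

theorem constantCoeff_eq_zero_of_mem_forms {p : S} {k : ℤ} (hp : p ∈ forms k) (hk : k ≠ 0) :
    constantCoeff p = 0 :=
  IsWeightedHomogeneous.coeff_eq_zero hp 0 (by simpa using hk.symm)

/-- The component of degree `k` of a polynomial. -/
noncomputable def component (k : ℤ) : S →ₗ[ℂ] S :=
  weightedHomogeneousComponent (fun _ : Fin 3 => (1 : ℤ)) k

theorem component_mem (k : ℤ) (p : S) : component k p ∈ forms k :=
  weightedHomogeneousComponent_mem _ _ _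

theorem component_of_mem {k l : ℤ} {p : S} (hp : p ∈ forms l) :
    component k p = if k = l then p else 0 :=
  weightedHomogeneousComponent_of_mem hp

theorem component_self {k : ℤ} {p : S} (hp : p ∈ forms k) : component k p = p := by
  rw [component_of_mem hp, if_pos rfl]

theorem monomial_mem_forms (s : Fin 3 →₀ ℕ) (a : ℂ) :
    monomial s a ∈ forms (Finsupp.weight (fun _ : Fin 3 => (1 : ℤ)) s) :=
  isWeightedHomogeneous_monomial _ _ _ rfl

/-- Multiplication by a form shifts degrees; this is why graded maps commute with taking components.
-/
theorem component_mul {q : S} {l : ℤ} (hq : q ∈ forms l) (k : ℤ) (p : S) :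
    component k (p * q) = component (k - l) p * q := by
  induction p using MvPolynomial.induction_on' with
  | add p₁ p₂ h₁ h₂ => rw [add_mul, map_add, map_add, add_mul, h₁, h₂]
  | monomial s a =>
    rw [component_of_mem (mul_mem_forms (monomial_mem_forms s a) hq),
      component_of_mem (monomial_mem_forms s a)]
    by_cases h : k = Finsupp.weight (fun _ : Fin 3 => (1 : ℤ)) s + l
    · rw [if_pos h, if_pos (by omega)]
    · rw [if_neg h, if_neg (by omega), zero_mul]

/-- A form of degree zero is a constant. -/
theorem component_zero_eq_C (p : S) : component 0 p = C (constantCoeff p) := by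
  ext s
  change coeff s (weightedHomogeneousComponent _ _ _) = _
  rw [coeff_weightedHomogeneousComponent, coeff_C]
  by_cases hs : s = 0
  · subst hs; simp [constantCoeff]
  · rw [if_neg, if_neg (Ne.symm hs)]
    intro h
    apply hs
    rw [Finsupp.weight_apply, Finsupp.sum] at h
    rw [Finset.sum_eq_zero_iff_of_nonneg (fun i _ => by simp)] at h
    ext i
    by_contra hi
    exact hi (by simpa using h i (Finsupp.mem_support_iff.2 hi))

theorem sum_component (p : S) (K : Finset ℤ)
    (hK : ∀ s ∈ p.support, Finsupp.weight (fun _ : Fin 3 => (1 : ℤ)) s ∈ K) :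
    ∑ k ∈ K, component k p = p := by
  ext s
  rw [coeff_sum]
  simp only [component, coeff_weightedHomogeneousComponent, Finset.sum_ite_eq]
  split_ifs with h
  · rfl
  · by_contra hne
    exact h (hK s (mem_support_iff.2 (Ne.symm hne)))

/-- The piece of degree `k` of the graded module `⨁ⱼ S(-b j)`. -/
noncomputable def gradedPiece {p : ℕ} (b : Fin p → ℤ) (k : ℤ) : Submodule ℂ (Fin p → S) :=
  Submodule.pi Set.univ fun j => forms (k - b j)

theorem mem_gradedPiece {p : ℕ} {b : Fin p → ℤ} {k : ℤ} {v : Fin p → S} :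
    v ∈ gradedPiece b k ↔ ∀ j, v j ∈ forms (k - b j) := by
  simp [gradedPiece]

/-- The component of degree `k` of an element of the graded module `⨁ⱼ S(-b j)`. -/
noncomputable def gradedComponent {p : ℕ} (b : Fin p → ℤ) (k : ℤ) :
    (Fin p → S) →ₗ[ℂ] (Fin p → S) :=
  LinearMap.pi fun j => component (k - b j) ∘ₗ LinearMap.proj j

theorem gradedComponent_apply {p : ℕ} (b : Fin p → ℤ) (k : ℤ) (v : Fin p → S) (j : Fin p) :
    gradedComponent b k v j = component (k - b j) (v j) := rfl

theorem gradedComponent_mem {p : ℕ} (b : Fin p → ℤ) (k : ℤ) (v : Fin p → S) :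
    gradedComponent b k v ∈ gradedPiece b k :=
  mem_gradedPiece.2 fun _ => component_mem _ _

theorem gradedComponent_self {p : ℕ} {b : Fin p → ℤ} {k : ℤ} {v : Fin p → S}
    (hv : v ∈ gradedPiece b k) : gradedComponent b k v = v :=
  funext fun j => component_self (mem_gradedPiece.1 hv j)

theorem gradedComponent_smul {p : ℕ} {b : Fin p → ℤ} {l : ℤ} {v : Fin p → S}
    (hv : v ∈ gradedPiece b l) (k : ℤ) (c : S) :
    gradedComponent b k (c • v) = component (k - l) c • v := by
  funext j
  rw [gradedComponent_apply, Pi.smul_apply, smul_eq_mul, component_mul (mem_gradedPiece.1 hv j),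
    Pi.smul_apply, smul_eq_mul]
  rw [sub_sub_sub_cancel_right]

theorem exists_sum_gradedComponent {p : ℕ} (b : Fin p → ℤ) (v : Fin p → S) :
    ∃ K : Finset ℤ, ∑ k ∈ K, gradedComponent b k v = v := by
  classical
  refine ⟨Finset.univ.biUnion fun j => (v j).support.image fun s =>
    Finsupp.weight (fun _ : Fin 3 => (1 : ℤ)) s + b j, ?_⟩
  funext j
  rw [Finset.sum_apply]
  simp only [gradedComponent_apply]
  rw [← Finset.sum_image (f := fun k => component k (v j)) (g := fun k => k - b j)
    (by intro x _ y _ h; simpa using h)]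
  apply sum_component
  intro s hs
  refine Finset.mem_image.2 ⟨Finsupp.weight (fun _ : Fin 3 => (1 : ℤ)) s + b j, ?_, by ring⟩
  exact Finset.mem_biUnion.2 ⟨j, Finset.mem_univ _, Finset.mem_image.2 ⟨s, hs, rfl⟩⟩

theorem map_eq_sum_smul {p : ℕ} {M : Type*} [AddCommGroup M] [Module S M]
    (φ : (Fin p → S) →ₗ[S] M) (v : Fin p → S) : φ v = ∑ j, v j • φ (Pi.single j 1) := by
  conv_lhs => rw [pi_eq_sum_univ' v, map_sum]
  refine Finset.sum_congr rfl fun j _ => ?_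
  rw [← map_smul]

theorem isGradedHom_iff {p q : ℕ} {b : Fin p → ℤ} {a : Fin q → ℤ}
    {φ : (Fin p → S) →ₗ[S] (Fin q → S)} :
    IsGradedHom b a φ ↔ ∀ j, φ (Pi.single j 1) ∈ gradedPiece a (b j) := by
  simp only [IsGradedHom, mem_gradedPiece, mem_forms]

theorem IsGradedHom.gradedComponent {p q : ℕ} {b : Fin p → ℤ} {a : Fin q → ℤ}
    {φ : (Fin p → S) →ₗ[S] (Fin q → S)} (h : IsGradedHom b a φ) (k : ℤ) (v : Fin p → S) :
    gradedComponent a k (φ v) = φ (gradedComponent b k v) := by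
  rw [map_eq_sum_smul φ v, map_eq_sum_smul φ (PlaneCurve.gradedComponent b k v), map_sum]
  exact Finset.sum_congr rfl fun j _ => gradedComponent_smul (isGradedHom_iff.1 h j) k (v j)

theorem IsGradedHom.map_mem {p q : ℕ} {b : Fin p → ℤ} {a : Fin q → ℤ}
    {φ : (Fin p → S) →ₗ[S] (Fin q → S)} (h : IsGradedHom b a φ) {k : ℤ} {v : Fin p → S}
    (hv : v ∈ gradedPiece b k) : φ v ∈ gradedPiece a k := by
  rw [← gradedComponent_self hv, ← h.gradedComponent]
  exact gradedComponent_mem _ _ _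

/-- A homogeneous element of the range has a homogeneous preimage, namely a component of any
preimage. Exactness can thus be counted degree by degree. -/
theorem IsGradedHom.map_gradedPiece {p q : ℕ} {b : Fin p → ℤ} {a : Fin q → ℤ}
    {φ : (Fin p → S) →ₗ[S] (Fin q → S)} (h : IsGradedHom b a φ) (k : ℤ) :
    (gradedPiece b k).map (φ.restrictScalars ℂ) =
      (LinearMap.range φ).restrictScalars ℂ ⊓ gradedPiece a k := by
  apply le_antisymm
  · rintro _ ⟨v, hv, rfl⟩
    exact ⟨⟨v, rfl⟩, h.map_mem hv⟩
  · rintro _ ⟨⟨v, rfl⟩, hv⟩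
    exact ⟨PlaneCurve.gradedComponent b k v, gradedComponent_mem _ _ _,
      (h.gradedComponent k v).symm.trans (gradedComponent_self hv)⟩

/-! ### Minimal homogeneous generators. -/

/-- In a relation between minimal homogeneous generators the coefficients lie in the ideal
`(x, y, z)`. -/
theorem constantCoeff_eq_zero_of_sum_smul_eq_zero {q m : ℕ} {a : Fin q → ℤ} {δ : Fin m → ℤ}
    {ρ : Fin m → (Fin q → S)} (hρ : ∀ i, ρ i ∈ gradedPiece a (δ i))
    (hmin : ∀ j, ρ j ∉ Submodule.span S (ρ '' {i | i ≠ j})) {c : Fin m → S}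
    (hc : ∑ i, c i • ρ i = 0) (j : Fin m) : constantCoeff (c j) = 0 := by
  by_contra hj
  apply hmin j
  -- In degree `δ j` the coefficient of `ρ j` becomes the constant term of `c j`. If that is
  -- nonzero, it is a unit and `ρ j` is redundant.
  have h := congrArg (gradedComponent a (δ j)) hc
  rw [map_sum, map_zero] at h
  simp only [fun i => gradedComponent_smul (hρ i) (δ j) (c i)] at h
  rw [← Finset.add_sum_erase _ _ (Finset.mem_univ j), sub_self, component_zero_eq_C] at h
  have h' : ρ j = (C (constantCoeff (c j))⁻¹ : S) •
      -(∑ i ∈ Finset.univ.erase j, component (δ j - δ i) (c i) • ρ i) := by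
    rw [← eq_neg_of_add_eq_zero_left h, smul_smul, ← C_mul, inv_mul_cancel₀ hj, C_1, one_smul]
  rw [h']
  refine Submodule.smul_mem _ _ (Submodule.neg_mem _ (Submodule.sum_mem _ fun i hi => ?_))
  exact Submodule.smul_mem _ _
    (Submodule.subset_span ⟨i, Finset.ne_of_mem_erase hi, rfl⟩)

/-- A graded submodule of `⨁ⱼ S(-b j)` has a minimal finite family of homogeneous generators. -/
theorem exists_minimal_homogeneous_generators {p : ℕ} (b : Fin p → ℤ)
    (N : Submodule S (Fin p → S)) (hN : ∀ k, ∀ v ∈ N, gradedComponent b k v ∈ N) :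
    ∃ (t : ℕ) (e : Fin t → ℤ) (n : Fin t → (Fin p → S)),
      (∀ i, n i ∈ gradedPiece b (e i)) ∧ Submodule.span S (Set.range n) = N ∧
      ∀ j, n j ∉ Submodule.span S (n '' {i | i ≠ j}) := by
  classical
  let H : Set (Fin p → S) := {v | v ∈ N ∧ ∃ k, v ∈ gradedPiece b k}
  have hH : Submodule.span S H = N := by
    apply le_antisymm (Submodule.span_le.2 fun v hv => hv.1)
    intro v hv
    obtain ⟨K, hK⟩ := exists_sum_gradedComponent b v
    rw [← hK]
    exact Submodule.sum_mem _ fun k _ =>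
      Submodule.subset_span ⟨hN k v hv, k, gradedComponent_mem _ _ _⟩
  have hfg : (Submodule.span S H).FG := IsNoetherian.noetherian _
  rw [Submodule.fg_span_iff_fg_span_finset_subset] at hfg
  obtain ⟨T, hTH, hT⟩ := hfg
  -- A finite homogeneous generating set of least cardinality has no redundant element.
  have hex : ∃ t, ∃ T : Finset (Fin p → S),
      T.card = t ∧ ↑T ⊆ H ∧ Submodule.span S (T : Set (Fin p → S)) = N :=
    ⟨_, T, rfl, hTH, hT.symm.trans hH⟩
  obtain ⟨T, hcard, hTH, hT⟩ := Nat.find_spec hex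
  choose e he using fun v : T => (hTH v.2).2
  let E := T.equivFin.symm
  refine ⟨T.card, fun i => e (E i), fun i => E i, fun i => he (E i), ?_, ?_⟩
  · rw [← hT]
    congr 1
    ext v
    constructor
    · rintro ⟨i, rfl⟩
      exact (E i).2
    · intro hv
      exact ⟨E.symm ⟨v, hv⟩, by simp⟩
  · intro j hj
    refine Nat.find_min hex (m := (T.erase (E j)).card) ?_
      ⟨T.erase (E j), rfl, fun v hv => hTH (Finset.mem_of_mem_erase hv), ?_⟩
    · rw [← hcard]
      exact Finset.card_erase_lt_of_mem (E j).2
    · have hsub : (fun i => (E i : Fin p → S)) '' {i | i ≠ j} ⊆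
          (T.erase (E j) : Finset (Fin p → S)) := by
        rintro _ ⟨i, hi, rfl⟩
        refine Finset.mem_erase.2 ⟨fun h => hi (E.injective (Subtype.ext h)), (E i).2⟩
      have hj' := Submodule.span_mono hsub hj
      apply le_antisymm
      · rw [← hT]
        exact Submodule.span_mono (Finset.erase_subset _ _)
      · rw [← hT, Submodule.span_le]
        intro v hv
        by_cases h : v = E j
        · rw [h]
          exact hj'
        · exact Submodule.subset_span (Finset.mem_erase.2 ⟨h, hv⟩)

/-! ### Independence of minimal third syzygies. -/

theorem mem_of_X_mul_mem {s : Set (Fin 3)} {i : Fin 3} (hi : i ∉ s) {a : S}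
    (h : X i * a ∈ Ideal.span (X '' s : Set S)) : a ∈ Ideal.span (X '' s : Set S) := by
  rw [mem_ideal_span_X_image] at h ⊢
  intro m hm
  obtain ⟨j, hj, hm'⟩ := h (Finsupp.single i 1 + m) (by
    rw [mem_support_iff, coeff_X_mul]
    exact mem_support_iff.1 hm)
  refine ⟨j, hj, ?_⟩
  have hij : i ≠ j := fun h => hi (h ▸ hj)
  simpa [Finsupp.single_apply, hij] using hm'

/-- A Krull intersection statement, checked on monomials: a monomial `m` of `a` divisible by no
variable of `s` cannot come from a multiple of `X i ^ (m i + 1)`. -/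
theorem mem_of_forall_mem_sup_pow {s : Set (Fin 3)} {i : Fin 3} {a : S}
    (h : ∀ k : ℕ, a ∈ Ideal.span (X '' s : Set S) ⊔ Ideal.span {(X i : S) ^ k}) :
    a ∈ Ideal.span (X '' s : Set S) := by
  rw [mem_ideal_span_X_image]
  intro m hm
  by_contra hcon
  obtain ⟨u, hu, w, hw, rfl⟩ := Submodule.mem_sup.1 (h (m i + 1))
  obtain ⟨w, rfl⟩ := Ideal.mem_span_singleton'.1 hw
  rw [mem_ideal_span_X_image] at hu
  apply mem_support_iff.1 hm
  rw [coeff_add, X_pow_eq_monomial, coeff_mul_monomial', if_neg, add_zero]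
  · by_contra hne
    exact hcon (hu m (mem_support_iff.2 hne))
  · intro hle
    have := hle i
    simp at this

theorem span_X_image_insert (s : Set (Fin 3)) (i : Fin 3) :
    Ideal.span (X '' insert i s : Set S) = Ideal.span (X '' s) ⊔ Ideal.span {X i} := by
  rw [Set.image_insert_eq, Ideal.span_insert, sup_comm]

/-- If `x` is regular on `N / I N`, and the coefficients of a combination of the `n i` lying in
`(I + (x)) N` lie in `I + (x)`, then the coefficients of a combination of the `n i` lying in `I N`
lie in `I`. -/
theorem coeff_mem_of_sum_mem {M : Type*} [AddCommGroup M] [Module S M] {N : Submodule S M}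
    {t : ℕ} {n : Fin t → M} (hn : ∀ i, n i ∈ N) {I : Ideal S} {x : S}
    (hreg : ∀ u ∈ N, x • u ∈ I • N → u ∈ I • N)
    (hI : ∀ a, (∀ k : ℕ, a ∈ I ⊔ Ideal.span {x ^ k}) → a ∈ I)
    (hQ : ∀ c : Fin t → S, ∑ i, c i • n i ∈ (I ⊔ Ideal.span {x}) • N →
      ∀ i, c i ∈ I ⊔ Ideal.span {x})
    (c : Fin t → S) (hc : ∑ i, c i • n i ∈ I • N) (i : Fin t) : c i ∈ I := by
  apply hI
  intro k
  induction k generalizing c i with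
  | zero => simp
  | succ k ih =>
    -- Write `c = d + x c'` with `d` in `I`. Regularity of `x` puts the combination with
    -- coefficients `c'` in `I N`, so the induction hypothesis applies to `c'` and gains one power
    -- of `x`.
    have h := hQ c (Submodule.smul_mono_left le_sup_left hc)
    choose d hd w hw hdw using fun i => Submodule.mem_sup.1 (h i)
    choose c' hc' using fun i => Ideal.mem_span_singleton'.1 (hw i)
    have hsum : ∑ i, c' i • n i ∈ I • N := by
      refine hreg _ (Submodule.sum_mem _ fun i _ => Submodule.smul_mem _ _ (hn i)) ?_
      have : x • ∑ i, c' i • n i = ∑ i, c i • n i - ∑ i, d i • n i := by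
        rw [Finset.smul_sum, ← Finset.sum_sub_distrib]
        refine Finset.sum_congr rfl fun i _ => ?_
        rw [← hdw, ← hc', smul_smul, ← sub_smul]
        congr 1
        ring
      rw [this]
      exact Submodule.sub_mem _ hc
        (Submodule.sum_mem _ fun i _ => Submodule.smul_mem_smul (hd i) (hn i))
    obtain ⟨u, hu, v, hv, huv⟩ := Submodule.mem_sup.1 (ih c' hsum i)
    obtain ⟨v, rfl⟩ := Ideal.mem_span_singleton'.1 hv
    rw [← hdw, ← hc', ← huv]
    refine Submodule.mem_sup.2 ⟨d i + u * x, I.add_mem (hd i) (I.mul_mem_right _ hu),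
      v * x ^ (k + 1), Ideal.mem_span_singleton'.2 ⟨v, rfl⟩, by ring⟩

theorem mem_span_singleton_smul {M : Type*} [AddCommGroup M] [Module S M] {N : Submodule S M}
    {x : S} {u : M} : u ∈ Ideal.span {x} • N ↔ ∃ a ∈ N, x • a = u := by
  rw [Submodule.ideal_span_singleton_smul, Submodule.mem_smul_pointwise_iff_exists]

section Regular

variable {p q : ℕ} {M : Type*} [AddCommGroup M] [Module S M]
  {φ : (Fin p → S) →ₗ[S] (Fin q → S)} {χ : (Fin q → S) →ₗ[S] M}

theorem exists_smul_eq_of_X_smul_eq {i j : Fin 3} (hij : i ≠ j) {u a : Fin p → S}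
    (h : (X j : S) • a = (X i : S) • u) : ∃ w, u = (X j : S) • w ∧ a = (X i : S) • w := by
  have hdvd : ∀ l, ∃ w, u l = X j * w := by
    intro l
    have hl : X i * u l ∈ Ideal.span (X '' {j} : Set S) := by
      rw [Set.image_singleton, Ideal.mem_span_singleton]
      exact ⟨a l, (congrFun h l).symm⟩
    have := mem_of_X_mul_mem (by simpa using hij) hl
    rwa [Set.image_singleton, Ideal.mem_span_singleton] at this
  choose w hw using hdvd
  refine ⟨w, funext hw, ?_⟩
  have hu : u = (X j : S) • w := funext hw
  rw [hu, smul_comm] at h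
  exact smul_right_injective _ (X_ne_zero j) h

/-- From `X i • u = X j • a` follow `u = X j • w` and `a = X i • w`; then `φ a = 0` forces `φ w =
0`, the target of `φ` being torsion-free. -/
theorem X_regular_on_ker_mod_X {i j : Fin 3} (hij : i ≠ j) {u : Fin p → S}
    (h : (X i : S) • u ∈ Ideal.span {(X j : S)} • LinearMap.ker φ) :
    u ∈ Ideal.span {(X j : S)} • LinearMap.ker φ := by
  obtain ⟨a, ha, hau⟩ := mem_span_singleton_smul.1 h
  obtain ⟨w, hu, haw⟩ := exists_smul_eq_of_X_smul_eq hij hau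
  refine mem_span_singleton_smul.2 ⟨w, ?_, hu.symm⟩
  rw [LinearMap.mem_ker, haw, map_smul] at ha
  exact (smul_eq_zero.1 ha).resolve_left (X_ne_zero i)

/-- Coordinatewise `n = X l • u + X j • v`, and `φ n = 0` gives `φ u = X j • w`, `φ v = -X l • w`.
As `M` is torsion-free, `χ w = 0`, so `w = φ t` by exactness. Replacing `u` by `u - X j • t` and `v`
by `v + X l • t` moves both into `ker φ`. -/
theorem X_regular_on_ker_mod_X_X [Module.IsTorsionFree S M] {i j l : Fin 3} (hij : i ≠ j)
    (hil : i ≠ l) (hjl : j ≠ l) (hex : LinearMap.range φ = LinearMap.ker χ) {n : Fin p → S}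
    (hn : n ∈ LinearMap.ker φ)
    (h : (X i : S) • n ∈
      (Ideal.span {(X l : S)} ⊔ Ideal.span {(X j : S)}) • LinearMap.ker φ) :
    n ∈ (Ideal.span {(X l : S)} ⊔ Ideal.span {(X j : S)}) • LinearMap.ker φ := by
  rw [Submodule.sup_smul] at h ⊢
  obtain ⟨_, ha, _, hb, hab⟩ := Submodule.mem_sup.1 h
  obtain ⟨a, ha, rfl⟩ := mem_span_singleton_smul.1 ha
  obtain ⟨b, hb, rfl⟩ := mem_span_singleton_smul.1 hb
  have hcoord : ∀ k, ∃ u v, n k = X l * u + X j * v := by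
    intro k
    have hk : X i * n k ∈ Ideal.span (X '' {l, j} : Set S) := by
      rw [Set.image_pair, Ideal.mem_span_pair]
      refine ⟨a k, b k, ?_⟩
      rw [mul_comm, mul_comm (b k)]
      exact congrFun hab k
    have := mem_of_X_mul_mem (by simp [hij, hil]) hk
    rw [Set.image_pair, Ideal.mem_span_pair] at this
    obtain ⟨u, v, huv⟩ := this
    exact ⟨u, v, by rw [← huv]; ring⟩
  choose u v huv using hcoord
  have hnuv : n = (X l : S) • u + (X j : S) • v := funext huv
  have h0 : (X l : S) • φ u = (X j : S) • (-φ v) := by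
    rw [LinearMap.mem_ker, hnuv, map_add, map_smul, map_smul] at hn
    rw [smul_neg]
    exact eq_neg_of_add_eq_zero_left hn
  obtain ⟨w, hw₁, hw₂⟩ := exists_smul_eq_of_X_smul_eq hjl h0
  have hw : w ∈ LinearMap.range φ := by
    have hu : χ (φ u) = 0 := LinearMap.mem_ker.1 (hex ▸ ⟨u, rfl⟩)
    rw [hex, LinearMap.mem_ker]
    rw [hw₂, map_smul] at hu
    exact (smul_eq_zero.1 hu).resolve_left (X_ne_zero j)
  obtain ⟨t, rfl⟩ := hw
  refine Submodule.mem_sup.2 ⟨(X l : S) • (u - (X j : S) • t),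
    mem_span_singleton_smul.2 ⟨_, ?_, rfl⟩, (X j : S) • (v + (X l : S) • t),
    mem_span_singleton_smul.2 ⟨_, ?_, rfl⟩, ?_⟩
  · rw [LinearMap.mem_ker, map_sub, map_smul, hw₂, sub_self]
  · rw [LinearMap.mem_ker, map_add, map_smul, ← hw₁, add_neg_cancel]
  · rw [hnuv, smul_sub, smul_add, smul_comm (X j : S) (X l : S) t]
    abel

theorem mem_span_X_univ {c : S} :
    c ∈ Ideal.span (X '' (Set.univ : Set (Fin 3)) : Set S) ↔ constantCoeff c = 0 := by
  rw [mem_ideal_span_X_image]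
  constructor
  · intro h
    by_contra hc
    obtain ⟨i, -, hi⟩ := h 0 (mem_support_iff.2 hc)
    exact hi rfl
  · intro hc m hm
    by_contra hcon
    push Not at hcon
    have : m = 0 := Finsupp.ext fun i => hcon i (Set.mem_univ i)
    exact mem_support_iff.1 hm (this ▸ hc)

/-- Minimal homogeneous generators of a third syzygy module over `ℂ[x, y, z]` are linearly
independent. -/
theorem linearIndependent_of_minimal [Module.IsTorsionFree S M]
    (hex : LinearMap.range φ = LinearMap.ker χ) {b : Fin p → ℤ} {t : ℕ} {e : Fin t → ℤ}
    {n : Fin t → (Fin p → S)} (hn : ∀ i, n i ∈ gradedPiece b (e i))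
    (hspan : Submodule.span S (Set.range n) = LinearMap.ker φ)
    (hmin : ∀ j, n j ∉ Submodule.span S (n '' {i | i ≠ j})) : LinearIndependent S n := by
  have hmem : ∀ i, n i ∈ LinearMap.ker φ := fun i => hspan ▸ Submodule.subset_span ⟨i, rfl⟩
  -- Start of a descent: modulo all three variables the claim is minimality of the generators. Each
  -- of `h2`, `h1`, `h0` then removes one variable; over the zero ideal the claim is linear
  -- independence.
  have h3 : ∀ c : Fin t → S,
      ∑ i, c i • n i ∈ (Ideal.span (X '' {2, 1} : Set S) ⊔ Ideal.span {X 0}) • LinearMap.ker φ →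
      ∀ i, c i ∈ Ideal.span (X '' {2, 1} : Set S) ⊔ Ideal.span {X 0} := by
    have huniv : Ideal.span (X '' {2, 1} : Set S) ⊔ Ideal.span {X 0} =
        Ideal.span (X '' (Set.univ : Set (Fin 3)) : Set S) := by
      rw [← span_X_image_insert]
      congr 2
      ext i
      fin_cases i <;> simp
    rw [huniv]
    intro c hc i
    rw [← hspan, Submodule.mem_ideal_smul_span_iff_exists_sum] at hc
    obtain ⟨a, ha, hac⟩ := hc
    rw [Finsupp.sum_fintype _ _ (by simp)] at hac
    have := constantCoeff_eq_zero_of_sum_smul_eq_zero hn hmin (c := fun i => c i - a i)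
      (by simp only [sub_smul, Finset.sum_sub_distrib, hac, sub_self]) i
    rw [mem_span_X_univ]
    rwa [map_sub, mem_span_X_univ.1 (ha i), sub_zero] at this
  have h2 := coeff_mem_of_sum_mem hmem (by
    intro u hu h
    rw [Set.image_pair, Ideal.span_insert] at h ⊢
    exact X_regular_on_ker_mod_X_X (by decide) (by decide) (by decide) hex hu h)
    (fun a => mem_of_forall_mem_sup_pow) h3
  have h21 : Ideal.span (X '' {2, 1} : Set S) = Ideal.span (X '' {2}) ⊔ Ideal.span {X 1} := by
    rw [← span_X_image_insert, Set.pair_comm]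
  rw [h21] at h2
  have h1 := coeff_mem_of_sum_mem hmem (by
    intro u _ h
    rw [Set.image_singleton] at h ⊢
    exact X_regular_on_ker_mod_X (by decide) h)
    (fun a => mem_of_forall_mem_sup_pow) h2
  have h20 : Ideal.span (X '' {2} : Set S) = Ideal.span (X '' ∅) ⊔ Ideal.span {X 2} := by
    rw [← span_X_image_insert, LawfulSingleton.insert_empty_eq]
  rw [h20] at h1
  have h0 := coeff_mem_of_sum_mem hmem (by
    intro u _ h
    rw [Set.image_empty, Ideal.span_empty, Submodule.bot_smul, Submodule.mem_bot] at h ⊢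
    exact (smul_eq_zero.1 h).resolve_left (X_ne_zero 2))
    (fun a => mem_of_forall_mem_sup_pow) h1
  rw [Fintype.linearIndependent_iff]
  intro c hc i
  have := h0 c (by rw [hc]; exact Submodule.zero_mem _) i
  simpa using this

end Regular

/-! ### Dimensions of graded pieces. -/

theorem forms_eq_bot {k : ℤ} (hk : k < 0) : forms k = ⊥ := by
  rw [eq_bot_iff]
  intro p hp
  rw [Submodule.mem_bot]
  by_contra hne
  obtain ⟨s, hs⟩ := exists_coeff_ne_zero hne
  have := mem_forms.1 hp s (mem_support_iff.2 hs)
  omega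

theorem forms_natCast_eq (k : ℕ) : forms (k : ℤ) =
    restrictSupport ℂ ((Finset.univ : Finset (Fin 3)).finsuppAntidiag k : Set (Fin 3 →₀ ℕ)) := by
  ext p
  rw [mem_forms, mem_restrictSupport_iff]
  refine forall₂_congr fun s _ => ?_
  simp [Finset.mem_finsuppAntidiag, Finsupp.degree_eq_sum, -Nat.cast_sum]

instance (k : ℤ) : FiniteDimensional ℂ (forms k) := by
  rcases lt_or_ge k 0 with hk | hk
  · rw [forms_eq_bot hk]
    infer_instance
  · lift k to ℕ using hk
    rw [forms_natCast_eq]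
    exact Module.Finite.of_basis (basisRestrictSupport ℂ _)

/-- The formula extends below `0` exactly as far as the roots `-1` and `-2` of the polynomial. -/
theorem two_mul_finrank_forms {k : ℤ} (hk : -2 ≤ k) :
    2 * (Module.finrank ℂ (forms k) : ℤ) = (k + 1) * (k + 2) := by
  rcases lt_or_ge k 0 with h | h
  · rw [forms_eq_bot h, finrank_bot]
    obtain rfl | rfl : k = -1 ∨ k = -2 := by omega
    · norm_num
    · norm_num
  · lift k to ℕ using h
    rw [forms_natCast_eq, Module.finrank_eq_nat_card_basis (basisRestrictSupport ℂ _),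
      Nat.card_coe_set_eq, Set.ncard_coe_finset, Finset.card_finsuppAntidiag_nat_eq_choose,
      Finset.card_univ, Fintype.card_fin, show 3 + k - 1 = k + 2 by omega,
      Nat.choose_symm_add, Nat.choose_two_right]
    have h2 : 2 ∣ (k + 2) * (k + 2 - 1) := Even.two_dvd (Nat.even_mul_pred_self _)
    have := Nat.mul_div_cancel' h2
    rw [show k + 2 - 1 = k + 1 by omega] at this ⊢
    have h := congrArg (Nat.cast : ℕ → ℤ) this
    rw [Nat.cast_mul] at h
    rw [← Nat.cast_ofNat (n := 2), h]
    push_cast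
    ring

/-- The graded piece of a free module is a product of spaces of forms. -/
noncomputable def gradedPieceEquiv {p : ℕ} (b : Fin p → ℤ) (k : ℤ) :
    gradedPiece b k ≃ₗ[ℂ] (∀ j, forms (k - b j)) where
  toFun v j := ⟨v.1 j, mem_gradedPiece.1 v.2 j⟩
  invFun v := ⟨fun j => v j, mem_gradedPiece.2 fun j => (v j).2⟩
  map_add' _ _ := rfl
  map_smul' _ _ := rfl
  left_inv _ := rfl
  right_inv _ := rfl

instance {p : ℕ} (b : Fin p → ℤ) (k : ℤ) : FiniteDimensional ℂ (gradedPiece b k) :=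
  (gradedPieceEquiv b k).symm.finiteDimensional

theorem finrank_gradedPiece {p : ℕ} (b : Fin p → ℤ) (k : ℤ) :
    Module.finrank ℂ (gradedPiece b k) = ∑ j, Module.finrank ℂ (forms (k - b j)) := by
  rw [(gradedPieceEquiv b k).finrank_eq, Module.finrank_pi_fintype]

theorem two_mul_finrank_gradedPiece {p : ℕ} {b : Fin p → ℤ} {k : ℤ} (hk : ∀ j, b j ≤ k) :
    2 * (Module.finrank ℂ (gradedPiece b k) : ℤ) =
      p * k ^ 2 + 3 * p * k + 2 * p - 2 * k * ∑ j, b j - 3 * ∑ j, b j + ∑ j, b j ^ 2 := by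
  rw [finrank_gradedPiece, Nat.cast_sum, Finset.mul_sum]
  have h : ∀ j, 2 * (Module.finrank ℂ (forms (k - b j)) : ℤ) =
      (k ^ 2 + 3 * k + 2) - (2 * k + 3) * b j + b j ^ 2 := by
    intro j
    rw [two_mul_finrank_forms (by linarith [hk j])]
    ring
  simp only [h, Finset.sum_add_distrib, Finset.sum_sub_distrib, Finset.sum_const, ← Finset.mul_sum,
    Finset.card_univ, Fintype.card_fin, nsmul_eq_mul]
  ring

theorem finrank_map_add_finrank_inf_ker {V W : Type*} [AddCommGroup V] [Module ℂ V]
    [AddCommGroup W] [Module ℂ W] (g : V →ₗ[ℂ] W) (U : Submodule ℂ V) [FiniteDimensional ℂ U] :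
    Module.finrank ℂ (U.map g) + Module.finrank ℂ (LinearMap.ker g ⊓ U : Submodule ℂ V) =
      Module.finrank ℂ U := by
  rw [← LinearMap.finrank_range_add_finrank_ker (g.domRestrict U), LinearMap.range_domRestrict,
    LinearMap.ker_domRestrict, inf_comm, ← Submodule.map_comap_subtype]
  congr 1
  exact Submodule.finrank_map_subtype_eq _ _

/-! ### Hilbert functions -/

theorem pderiv_mem_forms {f : S} {d : ℕ} (hf : f.IsHomogeneous d) (hd : 1 ≤ d) (i : Fin 3) :
    pderiv i f ∈ forms ((d : ℤ) - 1) := by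
  rw [← Nat.cast_pred hd, mem_forms_natCast]
  exact hf.pderiv

theorem jacobianMap_apply (f : S) (v : Fin 3 → S) :
    jacobianMap f v = ∑ i, v i * pderiv i f := by
  simp [jacobianMap, Fintype.linearCombination_apply]

theorem range_jacobianMap (f : S) : LinearMap.range (jacobianMap f) = jacobianIdeal f :=
  Fintype.range_linearCombination _ _

theorem component_jacobianMap {f : S} {d : ℕ} (hf : f.IsHomogeneous d) (hd : 1 ≤ d) (k : ℤ)
    (v : Fin 3 → S) : component k (jacobianMap f v) =
      jacobianMap f (gradedComponent (fun _ => (d : ℤ) - 1) k v) := by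
  rw [jacobianMap_apply, jacobianMap_apply, map_sum]
  exact Finset.sum_congr rfl fun i _ => component_mul (pderiv_mem_forms hf hd i) k (v i)

theorem map_jacobianMap_gradedPiece {f : S} {d : ℕ} (hf : f.IsHomogeneous d) (hd : 1 ≤ d)
    (k : ℤ) : (gradedPiece (fun _ => (d : ℤ) - 1) k).map ((jacobianMap f).restrictScalars ℂ) =
      (jacobianIdeal f).restrictScalars ℂ ⊓ forms k := by
  apply le_antisymm
  · rintro _ ⟨v, hv, rfl⟩
    refine ⟨range_jacobianMap f ▸ ⟨v, rfl⟩, ?_⟩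
    rw [← gradedComponent_self hv, LinearMap.restrictScalars_apply, ← component_jacobianMap hf hd]
    exact component_mem _ _
  · rintro p ⟨hp, hp'⟩
    obtain ⟨v, rfl⟩ : p ∈ LinearMap.range (jacobianMap f) := range_jacobianMap f ▸ hp
    exact ⟨gradedComponent _ k v, gradedComponent_mem _ _ _,
      (component_jacobianMap hf hd k v).symm.trans (component_self hp')⟩

theorem finrank_milnorComponent (f : S) (k : ℕ) :
    Module.finrank ℂ (milnorComponent f k) +
      Module.finrank ℂ ((jacobianIdeal f).restrictScalars ℂ ⊓ forms k : Submodule ℂ S) =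
      Module.finrank ℂ (forms k) := by
  rw [← finrank_map_add_finrank_inf_ker (Ideal.Quotient.mkₐ ℂ (jacobianIdeal f)).toLinearMap
    (forms k)]
  have h1 : homogeneousSubmodule (Fin 3) ℂ k = forms k := by
    ext p
    exact mem_forms_natCast.symm
  have h2 : LinearMap.ker (Ideal.Quotient.mkₐ ℂ (jacobianIdeal f)).toLinearMap =
      (jacobianIdeal f).restrictScalars ℂ := by
    ext p
    exact Ideal.Quotient.eq_zero_iff_mem
  rw [milnorComponent, h1, h2]

/-- The Hilbert function of `M(f)`, read off from a graded free resolution. -/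
theorem finrank_milnorComponent_of_resolution {f : S} {d : ℕ} (hf : f.IsHomogeneous d)
    (hd : 1 ≤ d) {p n : ℕ} {b : Fin p → ℤ} {e : Fin n → ℤ}
    {φ : (Fin p → S) →ₗ[S] (Fin 3 → S)} {ψ : (Fin n → S) →ₗ[S] (Fin p → S)}
    (hφ : IsGradedHom b (fun _ => (d : ℤ) - 1) φ) (hψ : IsGradedHom e b ψ)
    (hex : LinearMap.range φ = LinearMap.ker (jacobianMap f))
    (hex' : LinearMap.range ψ = LinearMap.ker φ) (hinj : Function.Injective ψ) (k : ℕ) :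
    (Module.finrank ℂ (milnorComponent f k) : ℤ) =
      Module.finrank ℂ (forms k) -
      Module.finrank ℂ (gradedPiece (fun _ : Fin 3 => (d : ℤ) - 1) k) +
      Module.finrank ℂ (gradedPiece b k) - Module.finrank ℂ (gradedPiece e k) := by
  have h0 := finrank_milnorComponent f k
  have h1 := finrank_map_add_finrank_inf_ker ((jacobianMap f).restrictScalars ℂ)
    (gradedPiece (fun _ : Fin 3 => (d : ℤ) - 1) k)
  have h2 := finrank_map_add_finrank_inf_ker (φ.restrictScalars ℂ) (gradedPiece b k)
  have h3 := finrank_map_add_finrank_inf_ker (ψ.restrictScalars ℂ) (gradedPiece e k)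
  rw [map_jacobianMap_gradedPiece hf hd, LinearMap.ker_restrictScalars, ← hex] at h1
  rw [hφ.map_gradedPiece, LinearMap.ker_restrictScalars, ← hex'] at h2
  rw [hψ.map_gradedPiece, LinearMap.ker_restrictScalars, LinearMap.ker_eq_bot.2 hinj,
    Submodule.restrictScalars_bot, bot_inf_eq, finrank_bot] at h3
  omega

/-! ### The Jacobian ideal of a reduced curve has codimension two -/

/-- A nonzero partial derivative has smaller degree than `p`, so if `p` divided all of them they
would all vanish, making `p` constant in characteristic zero. -/
theorem not_dvd_all_pderiv_of_irreducible {p : S} (hp : Irreducible p) :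
    ∃ i, ¬ p ∣ pderiv i p := by
  by_contra! hcon
  have hzero : ∀ i, pderiv i p = 0 := by
    intro i
    by_contra hne
    obtain ⟨q, hq⟩ := hcon i
    have hq0 : q ≠ 0 := by
      rintro rfl
      exact hne (by rw [hq, mul_zero])
    have hdeg : p.totalDegree ≤ (pderiv i p).totalDegree := by
      rw [hq, totalDegree_mul_of_isDomain hp.ne_zero hq0]
      exact Nat.le_add_right _ _
    obtain ⟨s, hs, hs'⟩ := Finset.exists_mem_eq_sup _ (support_nonempty.2 hne)
      fun s : Fin 3 →₀ ℕ => s.sum fun _ n => n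
    have hs'' : (pderiv i p).totalDegree = s.sum fun _ n => n := hs'
    have hmem : s + Finsupp.single i 1 ∈ p.support := by
      rw [mem_support_iff, coeff_pderiv] at hs
      exact mem_support_iff.2 (left_ne_zero_of_mul hs)
    have hle := le_totalDegree hmem
    rw [Finsupp.sum_add_index' (fun _ => rfl) (fun _ _ _ => rfl),
      Finsupp.sum_single_index rfl] at hle
    omega
  have hC : p = C (coeff 0 p) := by
    ext s
    rw [coeff_C]
    split_ifs with hs
    · rw [← hs]
    · obtain ⟨i, hi⟩ : ∃ i, s i ≠ 0 := by
        by_contra! h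
        exact hs (Finsupp.ext h).symm
      have h := congrArg (coeff (s - Finsupp.single i 1)) (hzero i)
      rw [coeff_pderiv, coeff_zero, tsub_add_cancel_of_le
        (Finsupp.single_le_iff.2 (Nat.one_le_iff_ne_zero.2 hi))] at h
      exact (mul_eq_zero.1 h).resolve_right (Nat.cast_add_one_ne_zero _)
  have hne : coeff 0 p ≠ 0 := by
    intro h
    rw [h, C_0] at hC
    exact hp.ne_zero hC
  apply hp.not_isUnit
  rw [hC]
  exact (isUnit_iff_ne_zero.2 hne).map C

/-- If `p` divides all partials, Euler's formula gives `f = p g`, with `p ∤ g` by squarefreeness.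
The product rule then makes `p` divide every `g * pderiv i p`, hence every `pderiv i p`. -/
theorem not_dvd_all_pderiv_of_squarefree {f : S} {d : ℕ} (hf : f.IsHomogeneous d) (hd : 1 ≤ d)
    (hsq : Squarefree f) {p : S} (hp : Irreducible p) : ∃ i, ¬ p ∣ pderiv i f := by
  by_contra! hcon
  have hpf : p ∣ f := by
    have h : p ∣ d • f := by
      rw [← hf.sum_X_mul_pderiv]
      exact Finset.dvd_sum fun i _ => Dvd.dvd.mul_left (hcon i) _
    rw [nsmul_eq_mul, ← map_natCast (C : ℂ →+* S)] at h
    have hunit : IsUnit (C (d : ℂ) : S) :=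
      (isUnit_iff_ne_zero.2 (Nat.cast_ne_zero.2 (by omega))).map C
    exact hunit.dvd_mul_left.1 h
  obtain ⟨g, rfl⟩ := hpf
  have hg : ¬ p ∣ g := by
    rintro ⟨g', rfl⟩
    exact hp.not_isUnit (hsq p ⟨g', by ring⟩)
  obtain ⟨i, hi⟩ := not_dvd_all_pderiv_of_irreducible hp
  have h := hcon i
  rw [pderiv_mul, dvd_add_left (Dvd.intro _ rfl)] at h
  exact (hp.prime.dvd_or_dvd h).elim hi hg

/-- Pigeonhole: otherwise one of the finitely many irreducible factors of `a` divides `b + t c` for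
two values of `t`, hence divides both `b` and `c`. -/
theorem exists_isRelPrime_add_C_mul {a b c : S} (ha : a ≠ 0)
    (h : ∀ p, Irreducible p → ¬ (p ∣ a ∧ p ∣ b ∧ p ∣ c)) :
    ∃ t : ℂ, IsRelPrime a (b + C t * c) := by
  classical
  by_contra! hcon
  have hfac : ∀ t : ℂ, ∃ q : (UniqueFactorizationMonoid.factors a).toFinset,
      (q : S) ∣ b + C t * c := by
    intro t
    by_contra! hq
    refine hcon t (WfDvdMonoid.isRelPrime_of_no_irreducible_factors (fun h => ha h.1) ?_)
    intro p hp hpa hpb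
    obtain ⟨q, hqm, hpq⟩ := UniqueFactorizationMonoid.exists_mem_factors_of_dvd ha hp hpa
    exact hq ⟨q, Multiset.mem_toFinset.2 hqm⟩ (hpq.symm.dvd.trans hpb)
  choose q hq using hfac
  obtain ⟨t, t', htt', heq⟩ := Finite.exists_ne_map_eq_of_infinite q
  have hqm := Multiset.mem_toFinset.1 (q t).2
  have h1 : (q t : S) ∣ c := by
    have h2 : (q t : S) ∣ C (t - t') * c := by
      have := dvd_sub (hq t) (heq ▸ hq t')
      rw [C_sub]
      convert this using 1
      ring
    exact ((isUnit_iff_ne_zero.2 (sub_ne_zero.2 htt')).map (C : ℂ →+* S)).dvd_mul_left.1 h2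
  exact h _ (UniqueFactorizationMonoid.irreducible_of_factor _ hqm)
    ⟨UniqueFactorizationMonoid.dvd_of_mem_factors hqm,
      (dvd_add_left (Dvd.dvd.mul_left h1 _)).1 (hq t), h1⟩

/-- The Jacobian ideal of a reduced curve contains two coprime forms of degree `d - 1`. -/
theorem exists_isRelPrime_mem_jacobianIdeal {f : S} {d : ℕ} (hf : f.IsHomogeneous d) (hd : 1 ≤ d)
    (hsq : Squarefree f) : ∃ g h : S, g ∈ forms ((d : ℤ) - 1) ∧ h ∈ forms ((d : ℤ) - 1) ∧
      g ∈ jacobianIdeal f ∧ h ∈ jacobianIdeal f ∧ g ≠ 0 ∧ IsRelPrime g h := by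
  -- Any irreducible serves here: a partial derivative that it does not divide is nonzero.
  have hX : Irreducible (X 0 : S) := (X_prime (i := (0 : Fin 3))).irreducible
  obtain ⟨i, hi⟩ := not_dvd_all_pderiv_of_squarefree hf hd hsq hX
  have hi0 : pderiv i f ≠ 0 := fun h => hi (h ▸ dvd_zero _)
  have hmem : ∀ j, pderiv j f ∈ jacobianIdeal f := fun j => Ideal.subset_span ⟨j, rfl⟩
  obtain ⟨t, ht⟩ := exists_isRelPrime_add_C_mul (b := pderiv (i + 1) f) (c := pderiv (i + 2) f) hi0
    (by
      rintro p hp ⟨h0, h1, h2⟩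
      obtain ⟨j, hj⟩ := not_dvd_all_pderiv_of_squarefree hf hd hsq hp
      obtain rfl | rfl | rfl : j = i ∨ j = i + 1 ∨ j = i + 2 := by
        clear * -
        revert i j
        decide
      exacts [hj h0, hj h1, hj h2])
  refine ⟨_, _, pderiv_mem_forms hf hd i, ?_, hmem i,
    Ideal.add_mem _ (hmem _) (Ideal.mul_mem_left _ _ (hmem _)), hi0, ht⟩
  rw [C_mul']
  exact Submodule.add_mem _ (pderiv_mem_forms hf hd _)
    (Submodule.smul_mem _ _ (pderiv_mem_forms hf hd _))

/-- The degree `k` piece of an ideal containing two coprime forms of degree `a`, by the Koszul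
complex. -/
theorem finrank_le_of_isRelPrime {I : Ideal S} {a : ℤ} {g h : S} (hg : g ∈ forms a)
    (hh : h ∈ forms a) (hgI : g ∈ I) (hhI : h ∈ I) (hg0 : g ≠ 0) (hgh : IsRelPrime g h) (k : ℤ) :
    Module.finrank ℂ (gradedPiece (fun _ : Fin 2 => a) k) ≤
      Module.finrank ℂ (I.restrictScalars ℂ ⊓ forms k : Submodule ℂ S) +
      Module.finrank ℂ (forms (k - a - a)) := by
  let κ : (Fin 2 → S) →ₗ[S] S := Fintype.linearCombination S ![g, h]
  have hκ : ∀ v, κ v = v 0 * g + v 1 * h := by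
    intro v
    simp [κ, Fintype.linearCombination_apply, Fin.sum_univ_two]
  let θ : S →ₗ[S] (Fin 2 → S) := LinearMap.toSpanSingleton S _ ![h, -g]
  rw [← finrank_map_add_finrank_inf_ker (κ.restrictScalars ℂ) (gradedPiece (fun _ : Fin 2 => a) k)]
  have hfin : FiniteDimensional ℂ (I.restrictScalars ℂ ⊓ forms k : Submodule ℂ S) :=
    Submodule.finiteDimensional_inf_right _ _
  refine add_le_add (Submodule.finrank_mono ?_) ?_
  · rintro _ ⟨v, hv, rfl⟩
    have hv := mem_gradedPiece.1 hv
    rw [LinearMap.restrictScalars_apply, hκ]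
    refine ⟨I.add_mem (I.mul_mem_left _ hgI) (I.mul_mem_left _ hhI), ?_⟩
    have h1 := mul_mem_forms (hv 0) hg
    have h2 := mul_mem_forms (hv 1) hh
    rw [sub_add_cancel] at h1 h2
    exact Submodule.add_mem _ h1 h2
  · refine le_trans (Submodule.finrank_mono (t := (forms (k - a - a)).map (θ.restrictScalars ℂ)) ?_)
      (Submodule.finrank_map_le _ _)
    rintro v ⟨hv, hv'⟩
    have hv' := mem_gradedPiece.1 hv'
    have hv : v 0 * g + v 1 * h = 0 := (hκ v).symm.trans hv
    -- By coprimality every syzygy of `(g, h)` is a multiple of `(h, -g)`.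
    obtain ⟨w, hw⟩ : g ∣ v 1 :=
      hgh.dvd_of_dvd_mul_right ⟨-v 0, by linear_combination hv⟩
    refine ⟨component (k - a - a) (-w), component_mem _ _, ?_⟩
    have h1 : component (k - a - a) w * g = v 1 := by
      rw [← component_mul hg, mul_comm, ← hw, component_self (hv' 1)]
    have h0 : v 0 = -component (k - a - a) w * h := by
      apply mul_right_cancel₀ hg0
      linear_combination hv + h * h1
    funext i
    fin_cases i
    · simp [θ, h0]
    · simp [θ, h1]

/-- The bound is the degree of the complete intersection of two coprime forms of degree `d - 1` in
`J_f`. -/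
theorem finrank_milnorComponent_le {f : S} {d : ℕ} (hf : f.IsHomogeneous d) (hd : 1 ≤ d)
    (hsq : Squarefree f) {k : ℕ} (hk : 2 * d ≤ k) :
    (Module.finrank ℂ (milnorComponent f k) : ℤ) ≤ ((d : ℤ) - 1) ^ 2 := by
  obtain ⟨g, h, hg, hh, hgI, hhI, hg0, hgh⟩ := exists_isRelPrime_mem_jacobianIdeal hf hd hsq
  have h1 := finrank_le_of_isRelPrime hg hh hgI hhI hg0 hgh k
  have h2 := finrank_milnorComponent f k
  have h3 := two_mul_finrank_gradedPiece (b := fun _ : Fin 2 => (d : ℤ) - 1) (k := k)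
    (by intro; omega)
  have h4 := two_mul_finrank_forms (k := (k : ℤ)) (by omega)
  have h5 := two_mul_finrank_forms (k := (k : ℤ) - (d - 1) - (d - 1)) (by omega)
  simp only [Fin.sum_univ_two, Nat.cast_ofNat] at h3
  zify at h1 h2
  nlinarith

/-! ### Numerical constraints on a resolution. -/

/-- The values at `k`, `2k`, `3k` have second difference `2 A k²`; once `A = 0`, those at `k`, `2k`
differ by `B k`. Both stay bounded. -/
theorem eq_zero_of_bounded {A B C D : ℤ} {K : ℕ}
    (h : ∀ k : ℕ, K ≤ k → |A * k ^ 2 + B * k + C| ≤ D) : A = 0 ∧ B = 0 := by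
  have hA : A = 0 := by
    by_contra hA
    have hA' : 1 ≤ |A| := Int.one_le_abs hA
    have hD : 0 ≤ D := (abs_nonneg _).trans (h K le_rfl)
    obtain ⟨k, hkK, hkD⟩ : ∃ k : ℕ, K ≤ k ∧ 2 * D < k :=
      ⟨max K (2 * D + 1).toNat, le_max_left _ _, by omega⟩
    have h1 := abs_le.1 (h k hkK)
    have h2 := abs_le.1 (h (2 * k) (by omega))
    have h3 := abs_le.1 (h (3 * k) (by omega))
    push_cast at h1 h2 h3
    have h4 : |A| * k ^ 2 ≤ 2 * D := by
      rw [← abs_of_nonneg (sq_nonneg (k : ℤ)), ← abs_mul, abs_le]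
      constructor <;> linarith
    nlinarith
  subst hA
  refine ⟨rfl, ?_⟩
  by_contra hB
  have hB' : 1 ≤ |B| := Int.one_le_abs hB
  obtain ⟨k, hkK, hkD⟩ : ∃ k : ℕ, K ≤ k ∧ 2 * D < k :=
    ⟨max K (2 * D + 1).toNat, le_max_left _ _, by omega⟩
  have h1 := abs_le.1 (h k hkK)
  have h2 := abs_le.1 (h (2 * k) (by omega))
  push_cast at h1 h2
  have h4 : |B| * k ≤ 2 * D := by
    rw [← abs_of_nonneg (Nat.cast_nonneg (α := ℤ) k), ← abs_mul, abs_le]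
    constructor <;> linarith
  nlinarith

/-- Numerical consequences of a graded free resolution of the Milnor algebra of a reduced curve. -/
theorem resolution_numerics {f : S} {d : ℕ} (hf : f.IsHomogeneous d)
    (hd : 1 ≤ d) (hsq : Squarefree f) {p n : ℕ} {b : Fin p → ℤ} {e : Fin n → ℤ}
    {φ : (Fin p → S) →ₗ[S] (Fin 3 → S)} {ψ : (Fin n → S) →ₗ[S] (Fin p → S)}
    (hφ : IsGradedHom b (fun _ => (d : ℤ) - 1) φ) (hψ : IsGradedHom e b ψ)
    (hex : LinearMap.range φ = LinearMap.ker (jacobianMap f))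
    (hex' : LinearMap.range ψ = LinearMap.ker φ) (hinj : Function.Injective ψ) :
    n + 2 = p ∧ ∑ i, e i = ∑ j, b j - 3 * ((d : ℤ) - 1) ∧
    ∀ᶠ k : ℕ in Filter.atTop, 2 * (Module.finrank ℂ (milnorComponent f k) : ℤ) =
      ∑ j, b j ^ 2 - ∑ i, e i ^ 2 - 3 * ((d : ℤ) - 1) ^ 2 := by
  obtain ⟨K, hKd, hKb, hKe⟩ : ∃ K : ℕ, 2 * d ≤ K ∧ (∀ j, b j ≤ K) ∧ ∀ i, e i ≤ K := by
    refine ⟨2 * d + ∑ j, (b j).toNat + ∑ i, (e i).toNat, by omega, fun j => ?_, fun i => ?_⟩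
    · have := Finset.single_le_sum (f := fun j => (b j).toNat) (fun _ _ => Nat.zero_le _)
        (Finset.mem_univ j)
      omega
    · have := Finset.single_le_sum (f := fun i => (e i).toNat) (fun _ _ => Nat.zero_le _)
        (Finset.mem_univ i)
      omega
  -- With `u = p - n - 2` and `v` the discrepancy of the degree sums, the coefficients are `u`, `3u
  -- + 2v` and `2u + 3v + w`, so boundedness gives `u = v = 0` and leaves the constant `w`.
  have hformula : ∀ k : ℕ, K ≤ k → 2 * (Module.finrank ℂ (milnorComponent f k) : ℤ) =
      ((p : ℤ) - n - 2) * k ^ 2 +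
      (3 * ((p : ℤ) - n - 2) + 2 * (∑ i, e i - (∑ j, b j - 3 * ((d : ℤ) - 1)))) * k +
      (2 * ((p : ℤ) - n - 2) + 3 * (∑ i, e i - (∑ j, b j - 3 * ((d : ℤ) - 1))) +
        (∑ j, b j ^ 2 - ∑ i, e i ^ 2 - 3 * ((d : ℤ) - 1) ^ 2)) := by
    intro k hk
    have hk' : (K : ℤ) ≤ k := by exact_mod_cast hk
    have h0 := finrank_milnorComponent_of_resolution hf hd hφ hψ hex hex' hinj k
    have h1 := two_mul_finrank_forms (k := (k : ℤ)) (by omega)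
    have h2 := two_mul_finrank_gradedPiece (b := fun _ : Fin 3 => (d : ℤ) - 1) (k := k)
      (by intro; omega)
    have h3 := two_mul_finrank_gradedPiece (k := (k : ℤ)) fun j => (hKb j).trans hk'
    have h4 := two_mul_finrank_gradedPiece (k := (k : ℤ)) fun i => (hKe i).trans hk'
    simp only [Fin.sum_univ_three, Nat.cast_ofNat] at h2
    linear_combination 2 * h0 + h1 - h2 + h3 - h4
  obtain ⟨hA, hB⟩ := eq_zero_of_bounded (D := 2 * ((d : ℤ) - 1) ^ 2) (K := K) (fun k hk => by
    rw [← hformula k hk, abs_of_nonneg (by positivity)]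
    linarith [finrank_milnorComponent_le hf hd hsq (hKd.trans hk)])
  have hE : ∑ i, e i - (∑ j, b j - 3 * ((d : ℤ) - 1)) = 0 := by
    rw [hA] at hB
    linarith
  refine ⟨by omega, by linarith, ?_⟩
  filter_upwards [Filter.eventually_ge_atTop K] with k hk
  rw [hformula k hk, hB, hA, hE]
  ring

/-! ### Existence of the resolution and uniqueness of its degrees. -/

/-- Minimal homogeneous generators of `D₀(f)` extend to a graded free resolution of `M(f)` whose
second map has a minimal matrix. -/
theorem exists_resolution {f : S} {a : ℤ} {m : ℕ} {b : Fin m → ℤ} {ρ : Fin m → (Fin 3 → S)}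
    (hρ : ∀ j, ρ j ∈ gradedPiece (fun _ => a) (b j))
    (hspan : Submodule.span S (Set.range ρ) = jacobianSyzygies f)
    (hmin : ∀ j, ρ j ∉ Submodule.span S (ρ '' {i | i ≠ j})) :
    ∃ (n : ℕ) (e : Fin n → ℤ) (ψ : (Fin n → S) →ₗ[S] (Fin m → S)),
      IsGradedHom b (fun _ => a) (Fintype.linearCombination S ρ) ∧ IsGradedHom e b ψ ∧
      IsMinimalHom ψ ∧
      LinearMap.range (Fintype.linearCombination S ρ) = LinearMap.ker (jacobianMap f) ∧
      LinearMap.range ψ = LinearMap.ker (Fintype.linearCombination S ρ) ∧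
      Function.Injective ψ := by
  have hφ : IsGradedHom b (fun _ => a) (Fintype.linearCombination S ρ) := by
    rw [isGradedHom_iff]
    intro j
    rw [Fintype.linearCombination_apply_single, one_smul]
    exact hρ j
  have hex : LinearMap.range (Fintype.linearCombination S ρ) = LinearMap.ker (jacobianMap f) :=
    (Fintype.range_linearCombination S ρ).trans hspan
  obtain ⟨n, e, ν, hν, hνspan, hνmin⟩ := exists_minimal_homogeneous_generators b
    (LinearMap.ker (Fintype.linearCombination S ρ)) (by
      intro k v hv
      rw [LinearMap.mem_ker, ← hφ.gradedComponent, LinearMap.mem_ker.1 hv, map_zero])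
  refine ⟨n, e, Fintype.linearCombination S ν, hφ, ?_, ?_, hex,
    (Fintype.range_linearCombination S ν).trans hνspan, ?_⟩
  · rw [isGradedHom_iff]
    intro i
    rw [Fintype.linearCombination_apply_single, one_smul]
    exact hν i
  · intro i j
    rw [Fintype.linearCombination_apply_single, one_smul]
    refine constantCoeff_eq_zero_of_sum_smul_eq_zero hρ hmin (c := ν i) ?_ j
    have : ν i ∈ LinearMap.ker (Fintype.linearCombination S ρ) :=
      hνspan ▸ Submodule.subset_span ⟨i, rfl⟩
    rwa [LinearMap.mem_ker, Fintype.linearCombination_apply] at this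
  · exact linearIndependent_iff_injective_fintypeLinearCombination.1
      (linearIndependent_of_minimal hex hν hνspan hνmin)

/-- The degrees of the free generators of a minimal injective graded map exceed those of the
target. -/
theorem lt_degree_of_isMinimalHom {p n : ℕ} {b : Fin p → ℤ} {e : Fin n → ℤ}
    {ψ : (Fin n → S) →ₗ[S] (Fin p → S)} (hψ : IsGradedHom e b ψ) (hmin : IsMinimalHom ψ)
    (hinj : Function.Injective ψ) (i : Fin n) : ∃ j, b j < e i := by
  have hne : ψ (Pi.single i 1) ≠ 0 := by
    rw [Ne, map_eq_zero_iff ψ hinj, Pi.single_eq_zero_iff]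
    exact one_ne_zero
  obtain ⟨j, hj⟩ := Function.ne_iff.1 hne
  refine ⟨j, ?_⟩
  have hmem : ψ (Pi.single i 1) j ∈ forms (e i - b j) := mem_forms.2 (hψ i j)
  by_contra! hle
  rcases hle.lt_or_eq with h | h
  · rw [forms_eq_bot (by omega)] at hmem
    exact hj hmem
  · apply hj
    rw [← component_self hmem, h, sub_self, component_zero_eq_C, hmin i j, C_0]
    rfl

theorem constantCoeff_eq_zero_of_mem_range {p n : ℕ} {ψ : (Fin n → S) →ₗ[S] (Fin p → S)}
    (hmin : IsMinimalHom ψ) {v : Fin p → S} (hv : v ∈ LinearMap.range ψ) (j : Fin p) :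
    constantCoeff (v j) = 0 := by
  obtain ⟨u, rfl⟩ := hv
  rw [map_eq_sum_smul ψ u, Finset.sum_apply, map_sum]
  refine Finset.sum_eq_zero fun i _ => ?_
  rw [Pi.smul_apply, smul_eq_mul, map_mul, hmin i j, mul_zero]

/-- Uniqueness of the number and the degrees of minimal generators, when one minimal family is
concentrated in a single degree. -/
theorem minimal_generators_unique {q m k n : ℕ} {a : Fin q → ℤ} {D : ℤ} {b : Fin k → ℤ}
    {ρ : Fin m → (Fin q → S)} (hρ : ∀ i, ρ i ∈ gradedPiece a D)
    (hmin : ∀ j, ρ j ∉ Submodule.span S (ρ '' {i | i ≠ j}))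
    {φ : (Fin k → S) →ₗ[S] (Fin q → S)} {ψ : (Fin n → S) →ₗ[S] (Fin k → S)}
    (hφ : IsGradedHom b a φ) (hψmin : IsMinimalHom ψ)
    (hspan : LinearMap.range φ = Submodule.span S (Set.range ρ))
    (hex : LinearMap.range ψ = LinearMap.ker φ) : k = m ∧ ∀ j, b j = D := by
  have hw : ∀ i, ∃ w, φ w = ρ i := fun i => by
    have : ρ i ∈ LinearMap.range φ := hspan ▸ Submodule.subset_span ⟨i, rfl⟩
    exact this
  choose w hw using hw
  have hc : ∀ j, ∃ c : Fin m → S, (∀ i, c i ∈ forms (b j - D)) ∧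
      ∑ i, c i • ρ i = φ (Pi.single j 1) := by
    intro j
    have hj : φ (Pi.single j 1) ∈ Submodule.span S (Set.range ρ) := hspan ▸ ⟨_, rfl⟩
    obtain ⟨c, hc⟩ := (Submodule.mem_span_range_iff_exists_fun S).1 hj
    refine ⟨fun i => component (b j - D) (c i), fun i => component_mem _ _, ?_⟩
    rw [← gradedComponent_self (isGradedHom_iff.1 hφ j), ← hc, map_sum]
    exact Finset.sum_congr rfl fun i _ => (gradedComponent_smul (hρ i) _ _).symm
  choose c hcdeg hc using hc
  -- Constant terms of the two changes of generators. `A * B = 1` as relations among the images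
  -- under `φ` of the basis vectors come from the minimal `ψ`; `B * A = 1` as the `ρ i` are minimal.
  let A : Matrix (Fin k) (Fin m) ℂ := fun j i => constantCoeff (c j i)
  let B : Matrix (Fin m) (Fin k) ℂ := fun i j => constantCoeff (w i j)
  have hAB : A * B = 1 := by
    ext j l
    have hker : Pi.single j 1 - ∑ i, c j i • w i ∈ LinearMap.range ψ := by
      rw [hex, LinearMap.mem_ker, map_sub, map_sum, ← hc j, sub_eq_zero]
      simp only [map_smul, hw]
    have h := constantCoeff_eq_zero_of_mem_range hψmin hker l
    rw [Pi.sub_apply, Finset.sum_apply, map_sub, map_sum, sub_eq_zero] at h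
    simp only [Pi.smul_apply, smul_eq_mul, map_mul] at h
    rw [Matrix.mul_apply, Matrix.one_apply, ← h, Pi.single_apply]
    by_cases hjl : j = l
    · simp [hjl]
    · rw [if_neg hjl, if_neg (Ne.symm hjl), map_zero]
  have hBA : B * A = 1 := by
    ext i l
    have hrel : ∑ l, (Pi.single i 1 - ∑ j, w i j • c j : Fin m → S) l • ρ l = 0 := by
      simp only [Pi.sub_apply, sub_smul, Finset.sum_sub_distrib, Finset.sum_apply, Pi.smul_apply,
        smul_eq_mul, Finset.sum_smul, mul_smul]
      rw [Finset.sum_comm]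
      simp only [← Finset.smul_sum, hc, ← map_eq_sum_smul φ, hw]
      simp [Pi.single_apply]
    have h := constantCoeff_eq_zero_of_sum_smul_eq_zero hρ hmin hrel l
    rw [Pi.sub_apply, Finset.sum_apply, map_sub, map_sum, sub_eq_zero] at h
    simp only [Pi.smul_apply, smul_eq_mul, map_mul] at h
    rw [Matrix.mul_apply, Matrix.one_apply, ← h, Pi.single_apply]
    by_cases hil : i = l
    · simp [hil]
    · rw [if_neg hil, if_neg (Ne.symm hil), map_zero]
  refine ⟨by simpa using Matrix.square_of_invertible A B hAB hBA, fun j => ?_⟩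
  -- If `b j ≠ D`, row `j` of `A` consists of constant terms of forms of nonzero degree, so it
  -- vanishes.
  by_contra hj
  have h := congrFun (congrFun hAB j) j
  rw [Matrix.mul_apply, Matrix.one_apply_eq, Finset.sum_eq_zero] at h
  · exact zero_ne_one h
  · intro i _
    simp only [A]
    rw [constantCoeff_eq_zero_of_mem_forms (hcdeg j i) (sub_ne_zero.2 hj), zero_mul]

/-- The degrees in a graded free resolution whose middle term is generated in one degree. -/
theorem degrees_of_resolution {f : S} {d r m n : ℕ} (hf : f.IsHomogeneous d)
    (hd : 3 ≤ d) (hsq : Squarefree f) {e : Fin n → ℤ}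
    {φ : (Fin m → S) →ₗ[S] (Fin 3 → S)} {ψ : (Fin n → S) →ₗ[S] (Fin m → S)}
    (hφ : IsGradedHom (fun _ => (d : ℤ) - 1 + r) (fun _ => (d : ℤ) - 1) φ)
    (hψ : IsGradedHom e (fun _ => (d : ℤ) - 1 + r) ψ) (hmin : IsMinimalHom ψ)
    (hex : LinearMap.range φ = LinearMap.ker (jacobianMap f))
    (hex' : LinearMap.range ψ = LinearMap.ker φ) (hinj : Function.Injective ψ) :
    n + 2 = m ∧ (∀ i, (d : ℤ) + r ≤ e i) ∧ ∑ i, (e i - (d + r - 1)) = 2 * r - d + 1 ∧ 1 ≤ r ∧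
    ∀ᶠ k : ℕ in Filter.atTop, 2 * (Module.finrank ℂ (milnorComponent f k) : ℤ) =
      m * ((d : ℤ) - 1 + r) ^ 2 - ∑ i, e i ^ 2 - 3 * ((d : ℤ) - 1) ^ 2 := by
  obtain ⟨hn, hsum, hhilb⟩ := resolution_numerics hf (by omega) hsq hφ hψ hex hex' hinj
  have hle : ∀ i, (d : ℤ) + r ≤ e i := by
    intro i
    obtain ⟨j, hj⟩ := lt_degree_of_isMinimalHom hψ hmin hinj i
    omega
  have hdiff : ∑ i, (e i - (d + r - 1)) = 2 * (r : ℤ) - d + 1 := by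
    rw [Finset.sum_sub_distrib, hsum, Finset.sum_const, Finset.sum_const, Finset.card_univ,
      Finset.card_univ, Fintype.card_fin, Fintype.card_fin, ← hn]
    simp only [nsmul_eq_mul]
    push_cast
    ring
  refine ⟨hn, hle, hdiff, ?_, ?_⟩
  · have : 0 ≤ ∑ i, (e i - (d + r - 1)) := Finset.sum_nonneg fun i _ => by linarith [hle i]
    omega
  · simpa using hhilb

end PlaneCurve

/-! ### The theorem. -/

theorem mainTheorem3 (f : PlaneCurve.S) (d r m : ℕ) (hC : PlaneCurve.IsCurveOfType f d r m) :
    -- a minimal resolution of the Milnor algebra exists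
    (∃ (n : ℕ) (e : Fin n → ℤ),
      PlaneCurve.HasMinimalResolution f d (fun _ : Fin m => (d : ℤ) - 1 + r) e) ∧
    -- the degrees in any minimal resolution
    (∀ (k n : ℕ) (b : Fin k → ℤ) (e : Fin n → ℤ), PlaneCurve.HasMinimalResolution f d b e →
      k = m ∧ n + 2 = m ∧ (∀ j, b j = (d : ℤ) - 1 + r) ∧
      (∃ ε : Fin n → ℤ, (∀ j, 1 ≤ ε j) ∧ (∀ j, e j = (d : ℤ) + r - 1 + ε j) ∧
        PlaneCurve.defect d r m = ∑ j, (ε j - 1)) ∧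
      (m = 3 → ∀ j, e j = 3 * (r : ℤ))) ∧
    -- the total Tjurina number
    (m = 3 → PlaneCurve.HasTotalTjurinaNumber f (3 * (r : ℤ) * ((d : ℤ) - 1 - r))) := by
  obtain ⟨hd, hf, hsq, -, ρ, hρ, hspan, hmin⟩ := hC
  have hρ' : ∀ j, ρ j ∈ PlaneCurve.gradedPiece (fun _ => (d : ℤ) - 1) ((d : ℤ) - 1 + r) := by
    intro j
    rw [PlaneCurve.mem_gradedPiece]
    intro i
    rw [add_sub_cancel_left, PlaneCurve.mem_forms_natCast]
    exact hρ j i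
  obtain ⟨n, e, ψ, hφ, hψ, hψmin, hex, hex', hinj⟩ := PlaneCurve.exists_resolution hρ' hspan hmin
  obtain ⟨hn, -, hsum, hr, hhilb⟩ :=
    PlaneCurve.degrees_of_resolution hf hd hsq hφ hψ hψmin hex hex' hinj
  refine ⟨⟨n, e, _, ψ, hφ, hψ, ?_, hψmin, hex, hex', hinj⟩, ?_, ?_⟩
  -- The entries of `φ` are forms of degree `r`, so its minimality rests on `1 ≤ r`, which the
  -- numerics supply.
  · intro j i
    refine PlaneCurve.constantCoeff_eq_zero_of_mem_forms (PlaneCurve.mem_forms.2 (hφ j i)) ?_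
    rw [add_sub_cancel_left]
    exact_mod_cast Nat.one_le_iff_ne_zero.1 hr
  · clear hφ hψ hψmin hex hex' hinj hn hsum hr hhilb
    rintro k n b e ⟨φ, ψ, hφ, hψ, -, hψmin, hex, hex', hinj⟩
    obtain ⟨rfl, hb⟩ := PlaneCurve.minimal_generators_unique hρ' hmin hφ hψmin
      (hex.trans hspan.symm) hex'
    obtain rfl : b = fun _ => (d : ℤ) - 1 + r := funext hb
    obtain ⟨hn, hle, hsum, -, -⟩ :=
      PlaneCurve.degrees_of_resolution hf hd hsq hφ hψ hψmin hex hex' hinj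
    refine ⟨rfl, hn, hb, ⟨fun i => e i - (d + r - 1), fun i => ?_, fun i => ?_, ?_⟩, ?_⟩
    · linarith [hle i]
    · ring
    · rw [Finset.sum_sub_distrib, hsum, PlaneCurve.defect, PlaneCurve.mMax, ← hn]
      simp
      ring
    · intro h3 j
      obtain rfl : n = 1 := by omega
      rw [Fin.sum_univ_one] at hsum
      rw [Subsingleton.elim j 0]
      linarith
  · rintro rfl
    obtain rfl : n = 1 := by omega
    rw [Fin.sum_univ_one] at hsum
    have he : e 0 = 3 * r := by linarith
    -- Twice the dimension is `3 (d - 1 + r)² - (3r)² - 3 (d - 1)² = 6 r (d - 1 - r)`.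
    filter_upwards [hhilb] with k hk
    rw [Fin.sum_univ_one, he] at hk
    push_cast at hk
    linarith
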